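/- **Setting.** Fix a finite relational schema, an infinite set of constants, and a countably infinite set of variables. A *conjunctive query* (CQ) $Q(\bar A)\,{:}\!-\,\zeta(\bar A,\bar B)$ has as body a nonempty finite conjunction of relational atoms over variables and constants, and every head variable occurs in the body. A *tgd* is a dependency $\phi(\bar X,\bar Y)\to\exists\bar Z\,\psi(\bar X,\bar Z)$ with $\phi,\psi$ finite conjunctions of relational atoms; an *egd* is a dependency $\phi\to U_1=U_2$, where every variable among $U_1,U_2$ occurs in $\phi$. A tgd is *regularized* if the set of atoms of $\psi$ cannot be split into two disjoint nonempty sets whose common variables all belong to $\bar X$; a set of dependencies is regularized if all its tgds are. A set-valued database $D$ consists of one finite set of tuples of constants per relation symbol. The *bag-set answer* $Q(D,BS)$ is the bag in which the multiplicity of a tuple $u$ is the number of assignments of constants to the body variables of $Q$ that satisfy the body in $D$ and map the head to $u$. We write $Q\equiv_{\Sigma,BS}Q'$ if $Q(D,BS)=Q'(D,BS)$ as bags for every set-valued database $D\models\Sigma$. **Chase.** A *chase step* $Q\Rightarrow^{\sigma}Q'$ with a homomorphism $h$ from the left-hand side $\phi$ of $\sigma$ to the body $\zeta$ of $Q$ is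 the following. If $\sigma$ is a tgd, it is applicable if $h$ does not extend to a homomorphism from $\phi\wedge\psi$ to $\zeta$, and $Q'$ is obtained by adding $\psi(h(\bar X),\bar Z)$ to the body of $Q$, where the variables $\bar Z$ are taken (after renaming) not to occur in $Q$. If $\sigma$ is an egd, it is applicable if $h(U_1)\ne h(U_2)$ and at least one of them is a variable, and $Q'$ is obtained by replacing, everywhere in $Q$, one of $h(U_1),h(U_2)$ that is a variable by the other. A *terminal chase result* $(Q)_{\Sigma,S}$ is the last query $Q_n$ of a finite sequence of chase steps with dependencies of $\Sigma$ that starts with $Q$, such that the canonical database of $Q_n$ (each variable regarded as a new constant, distinct from all other constants) satisfies $\Sigma$. **Assignment-fixing steps.** Let a regularized tgd $\sigma\in\Sigma$ with existential variables $Z_1,\dots,Z_m$ ($m\ge0$) be applicable to $Q$ with $h$. The *associated test query* is $$Q^{\sigma,h,\theta}(\bar A)\,{:}\!-\,\zeta(\bar A,\bar B)\wedge\psi(h(\bar X),\bar Z)\wedge\psi(h(\bar X),\theta(\bar Z)),$$ where $\theta$ renames $Z_1,\dots,Z_m$ to distinct fresh variables. The chase step with $\sigma$ and $h$ is *assignment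 fixing* if $Q^{\sigma,h,\theta}$ has a terminal chase result $(Q^{\sigma,h,\theta})_{\Sigma,S}$ in which, for each $i$, at most one of $Z_i$ and $\theta(Z_i)$ is left, in the sense that the chase has identified $Z_i$ with $\theta(Z_i)$ (both have been turned into the same term). **Theorem 4.3.** Let $\Sigma$ be a finite regularized set of tgds and egds, $Q$ a CQ query, $\sigma\in\Sigma$, and let $Q\Rightarrow^{\sigma}Q'$ be a chase step with homomorphism $h$. If $\sigma$ is a tgd, assume that the terminal chase result $(Q^{\sigma,h,\theta})_{\Sigma,S}$ of the associated test query exists. Then the step is sound under bag-set semantics, i.e. $Q\equiv_{\Sigma,BS}Q'$, if and only if it is an assignment-fixing tgd chase step or $\sigma$ is an egd. -/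

import Mathlib

namespace BagSetChase

/-- A database schema: finitely many relation symbols, each with an arity. -/
structure Schema where
  Rel : Type
  finite_rel : Finite Rel
  arity : Rel → ℕ

/-- A term is a variable (variables are named by natural numbers) or a constant from `C`. -/
inductive Term (C : Type) where
  | var (x : ℕ) : Term C
  | const (c : C) : Term C

/-- The value of a term in a domain `A`, where `ι` interprets the constants and `γ` the
variables. -/
def Term.eval {C A : Type} (ι : C → A) (γ : ℕ → A) : Term C → A
  | .var x => γ x
  | .const c => ι c

/-- Applying a substitution of terms for variables; constants are fixed. -/
def Term.subst {C : Type} (s : ℕ → Term C) (t : Term C) : Term C :=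
  t.eval Term.const s

/-- A relational atom `r(t₁, …, tₙ)`. -/
structure Atom (S : Schema) (C : Type) where
  rel : S.Rel
  args : Fin (S.arity rel) → Term C

variable {S : Schema} {C : Type}

def Atom.subst (s : ℕ → Term C) (a : Atom S C) : Atom S C :=
  ⟨a.rel, fun i => (a.args i).subst s⟩

/-- The variables that occur in an atom. -/
def Atom.vars (a : Atom S C) : Set ℕ := {x | ∃ i, a.args i = Term.var x}

/-- The variables that occur in a conjunction (list) of atoms. -/
def conjVars (φ : List (Atom S C)) : Set ℕ := {x | ∃ a ∈ φ, x ∈ a.vars}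

/-- A set-valued relational instance with values in `A` (one set of tuples per relation symbol). -/
def Instance (S : Schema) (A : Type) : Type := ∀ r : S.Rel, Set (Fin (S.arity r) → A)

/-- The conjunction `φ` is satisfied by the assignment `γ` w.r.t. the instance `D`. -/
def Holds {A : Type} (ι : C → A) (D : Instance S A) (γ : ℕ → A) (φ : List (Atom S C)) : Prop :=
  ∀ a ∈ φ, (fun i => (a.args i).eval ι γ) ∈ D a.rel

/-- A set-valued database over the constants `C`: every relation is a finite set of tuples. -/
structure Database (S : Schema) (C : Type) where
  inst : Instance S C
  finite_inst : ∀ r, (inst r).Finite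

/-- A tuple-generating dependency `lhs → ∃ Z, rhs`. Its universally quantified variables are those
of `lhs`; the existential variables `Z` are the variables of `rhs` that do not occur in `lhs`. -/
structure TGD (S : Schema) (C : Type) where
  lhs : List (Atom S C)
  rhs : List (Atom S C)

def TGD.exVars (t : TGD S C) : Set ℕ := conjVars t.rhs \ conjVars t.lhs

/-- An equality-generating dependency `lhs → left = right`; a variable in the equation has to
occur in `lhs`. -/
structure EGD (S : Schema) (C : Type) where
  lhs : List (Atom S C)
  left : Term C
  right : Term C
  left_mem : ∀ x, left = Term.var x → x ∈ conjVars lhs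
  right_mem : ∀ x, right = Term.var x → x ∈ conjVars lhs

/-- A dependency: a tgd or an egd. -/
inductive Dependency (S : Schema) (C : Type) where
  | tgd (t : TGD S C) : Dependency S C
  | egd (e : EGD S C) : Dependency S C

def Dependency.IsEgd (d : Dependency S C) : Prop := ∃ e, d = Dependency.egd e

/-- Satisfaction of a dependency in an instance whose domain interprets the constants by `ι`. -/
def Dependency.SatIn {A : Type} (ι : C → A) (D : Instance S A) : Dependency S C → Prop
  | .tgd t => ∀ γ : ℕ → A, Holds ι D γ t.lhs →
      ∃ γ' : ℕ → A, (∀ x ∈ conjVars t.lhs, γ' x = γ x) ∧ Holds ι D γ' t.rhs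
  | .egd e => ∀ γ : ℕ → A, Holds ι D γ e.lhs → e.left.eval ι γ = e.right.eval ι γ

/-- `D ⊨ Γ` for a database over the constants. -/
def Database.Models (D : Database S C) (Γ : Set (Dependency S C)) : Prop :=
  ∀ d ∈ Γ, d.SatIn id D.inst

/-- A tgd is regularized if the set of atoms of its right-hand side has no nonshared partition,
i.e. no partition into two disjoint nonempty sets all of whose common variables are universally
quantified. -/
def TGD.IsRegularized (t : TGD S C) : Prop :=
  ¬ ∃ P₁ P₂ : Set (Atom S C), P₁.Nonempty ∧ P₂.Nonempty ∧ Disjoint P₁ P₂ ∧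
    P₁ ∪ P₂ = {a | a ∈ t.rhs} ∧
    ∀ x : ℕ, (∃ a ∈ P₁, x ∈ a.vars) → (∃ b ∈ P₂, x ∈ b.vars) → x ∈ conjVars t.lhs

/-- A set of dependencies is regularized if each of its tgds is. -/
def IsRegularizedSet (Γ : Set (Dependency S C)) : Prop :=
  ∀ t : TGD S C, Dependency.tgd t ∈ Γ → t.IsRegularized

/-- A (safe) conjunctive query with `k` head positions and a nonempty body. -/
structure CQ (S : Schema) (C : Type) (k : ℕ) where
  head : Fin k → Term C
  body : List (Atom S C)
  body_ne : body ≠ []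
  safe : ∀ i x, head i = Term.var x → x ∈ conjVars body

variable {k : ℕ}

def CQ.vars (Q : CQ S C k) : Set ℕ := conjVars Q.body

/-- The query with the atoms `ψ` added to its body. -/
def CQ.extend (Q : CQ S C k) (ψ : List (Atom S C)) : CQ S C k where
  head := Q.head
  body := Q.body ++ ψ
  body_ne := by simp [Q.body_ne]
  safe := by
    intro i x hx
    obtain ⟨a, ha, hxa⟩ := Q.safe i x hx
    exact ⟨a, List.mem_append_left _ ha, hxa⟩

/-- The query with a substitution applied to its head and body. -/
def CQ.subst (s : ℕ → Term C) (Q : CQ S C k) : CQ S C k where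
  head := fun i => (Q.head i).subst s
  body := Q.body.map (Atom.subst s)
  body_ne := by simp [Q.body_ne]
  safe := by
    intro i x hx
    cases hq : Q.head i with
    | const c => simp [hq, Term.subst, Term.eval] at hx
    | var y =>
      obtain ⟨a, ha, j, hj⟩ := Q.safe i y hq
      refine ⟨a.subst s, List.mem_map_of_mem ha, j, ?_⟩
      rw [hq] at hx
      simpa [Atom.subst, hj] using hx

/-- The multiplicity of the tuple `u` in the bag `Q(D,BS)`, i.e. in the answer to `Q` on `D` under
bag-set semantics: the number of assignments of constants to the body variables of `Q` that satisfy
the body w.r.t. `D` and map the head to `u`. (Total assignments are restricted to the body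
variables, so that values elsewhere are not counted.) -/
noncomputable def CQ.bagSetMult (Q : CQ S C k) (D : Database S C) (u : Fin k → C) : ℕ∞ :=
  (Q.vars.domRestrict '' {γ : ℕ → C | Holds id D.inst γ Q.body ∧
    (fun i => (Q.head i).eval id γ) = u}).encard

/-- Bag-set equivalence under `Γ`: on every (set-valued) database that satisfies `Γ` the two
answers under bag-set semantics are the same bag. -/
def BagSetEquiv (Γ : Set (Dependency S C)) (Q Q' : CQ S C k) : Prop :=
  ∀ D : Database S C, D.Models Γ → ∀ u : Fin k → C, Q.bagSetMult D u = Q'.bagSetMult D u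

/-- `h` is a homomorphism from the conjunction `φ` to the conjunction `ξ` (only its values on the
variables of `φ` matter). -/
def IsHom (h : ℕ → Term C) (φ ξ : List (Atom S C)) : Prop := ∀ a ∈ φ, a.subst h ∈ ξ

/-- The chase of `Q` with the tgd `t` is applicable, using `h`. -/
def TGD.Applicable (t : TGD S C) (Q : CQ S C k) (h : ℕ → Term C) : Prop :=
  IsHom h t.lhs Q.body ∧
    ¬ ∃ h' : ℕ → Term C, (∀ x ∈ conjVars t.lhs, h' x = h x) ∧ IsHom h' (t.lhs ++ t.rhs) Q.body

/-- `ρ` renames the existential variables of `t` to distinct variables that do not occur in `Q`. -/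
def TGD.Fresh (t : TGD S C) (Q : CQ S C k) (ρ : ℕ → ℕ) : Prop :=
  Set.InjOn ρ t.exVars ∧ ∀ z ∈ t.exVars, ρ z ∉ Q.vars

open Classical in
/-- The right-hand side of `t`, where `h` is applied to the universal variables and the existential
variables are renamed by `ρ`. -/
noncomputable def TGD.instRhs (t : TGD S C) (h : ℕ → Term C) (ρ : ℕ → ℕ) : List (Atom S C) :=
  t.rhs.map (Atom.subst fun x => if x ∈ conjVars t.lhs then h x else Term.var (ρ x))

/-- `ChaseStep d h s Q Q'`: a chase step rewrites `Q` into `Q'` using the dependency `d` and the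
homomorphism `h`. The substitution `s` records what happens to the variables of `Q`: nothing in a
tgd step, while an egd step replaces all occurrences of one variable `x` by a term `v`. -/
inductive ChaseStep : Dependency S C → (ℕ → Term C) → (ℕ → Term C) → CQ S C k → CQ S C k → Prop
  | tgd {t : TGD S C} {h : ℕ → Term C} {ρ : ℕ → ℕ} {Q : CQ S C k}
      (happ : t.Applicable Q h) (hρ : t.Fresh Q ρ) :
      ChaseStep (.tgd t) h Term.var Q (Q.extend (t.instRhs h ρ))
  | egd {e : EGD S C} {h : ℕ → Term C} {Q : CQ S C k} {x : ℕ} {v : Term C}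
      (hhom : IsHom h e.lhs Q.body)
      (heq : (e.left.subst h = Term.var x ∧ e.right.subst h = v) ∨
        (e.right.subst h = Term.var x ∧ e.left.subst h = v))
      (hne : Term.var x ≠ v) :
      ChaseStep (.egd e) h (Function.update Term.var x v) Q
        (Q.subst (Function.update Term.var x v))

/-- `ChaseSeq Γ s Q Q'`: there is a finite `Γ`-chase sequence from `Q` to `Q'`, in the course of
which the variables of `Q` are replaced according to the (composed) substitution `s`. -/
inductive ChaseSeq (Γ : Set (Dependency S C)) : (ℕ → Term C) → CQ S C k → CQ S C k → Prop
  | refl (Q : CQ S C k) : ChaseSeq Γ Term.var Q Q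
  | step {d : Dependency S C} {h s s' : ℕ → Term C} {Q Q₁ Q₂ : CQ S C k}
      (hseq : ChaseSeq Γ s Q Q₁) (hd : d ∈ Γ) (hstep : ChaseStep d h s' Q₁ Q₂) :
      ChaseSeq Γ (fun x => (s x).subst s') Q Q₂

/-- The canonical database of `Q`, as a symbolic instance: each variable is kept as a new value,
different from all constants and from all other variables. -/
def CQ.canonical (Q : CQ S C k) : Instance S (Term C) :=
  fun r => {u | (⟨r, u⟩ : Atom S C) ∈ Q.body}

/-- `Qn` is a terminal result of the set-semantics chase of `Q` with `Γ`, with the variables of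
`Q` replaced according to `s` in the course of the chase. -/
def IsTerminalChase (Γ : Set (Dependency S C)) (Q : CQ S C k) (s : ℕ → Term C)
    (Qn : CQ S C k) : Prop :=
  ChaseSeq Γ s Q Qn ∧ ∀ d ∈ Γ, d.SatIn Term.const Qn.canonical

/-- Renamings `ρ`, `θ` suitable for an associated test query: both are fresh for `Q`, and no
variable is used by both. -/
def TGD.TestRenaming (t : TGD S C) (Q : CQ S C k) (ρ θ : ℕ → ℕ) : Prop :=
  t.Fresh Q ρ ∧ t.Fresh Q θ ∧ ∀ z ∈ t.exVars, ∀ w ∈ t.exVars, ρ z ≠ θ w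

/-- The associated test query: two copies of the right-hand side of `t` are added to `Q`, with
separate fresh variables (given by `ρ` and by `θ`) for the existential variables. -/
noncomputable def TGD.testQuery (t : TGD S C) (Q : CQ S C k) (h : ℕ → Term C) (ρ θ : ℕ → ℕ) :
    CQ S C k :=
  Q.extend (t.instRhs h ρ ++ t.instRhs h θ)

/-- The associated test query for `Q`, `t` and `h` has a terminal chase result. (It is unique up to
the choice of the fresh variables, so that this choice is immaterial.) -/
def TestChaseExists (Γ : Set (Dependency S C)) (Q : CQ S C k) (t : TGD S C)
    (h : ℕ → Term C) : Prop :=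
  ∃ ρ θ : ℕ → ℕ, t.TestRenaming Q ρ θ ∧
    ∃ (s : ℕ → Term C) (Qn : CQ S C k), IsTerminalChase Γ (t.testQuery Q h ρ θ) s Qn

/-- `t` is assignment fixing w.r.t. `Q` and `h`: in the terminal chase result of the associated
test query, of the two copies of each existential variable only one is left, i.e. the chase has
identified them. -/
def AssignmentFixing (Γ : Set (Dependency S C)) (Q : CQ S C k) (t : TGD S C)
    (h : ℕ → Term C) : Prop :=
  t.Applicable Q h ∧ ∃ ρ θ : ℕ → ℕ, t.TestRenaming Q ρ θ ∧
    ∃ (s : ℕ → Term C) (Qn : CQ S C k), IsTerminalChase Γ (t.testQuery Q h ρ θ) s Qn ∧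
      ∀ z ∈ t.exVars, s (ρ z) = s (θ z)

/-- The chase step that applies `d` to `Q` using `h` is an assignment-fixing (tgd) chase step. -/
def IsAssignmentFixingStep (Γ : Set (Dependency S C)) (d : Dependency S C) (h : ℕ → Term C)
    (Q : CQ S C k) : Prop :=
  ∃ t : TGD S C, d = Dependency.tgd t ∧ t.IsRegularized ∧ AssignmentFixing Γ Q t h

end BagSetChase

/-!
Both implications compare assignments through restriction of variables.

For an egd step every assignment that satisfies the body in a model of the egd already identifies
the two terms that the step identifies, so forgetting the eliminated variable is a bijection
between the assignments of the two queries.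

For a tgd step, restricting the assignments of `Q'` to the variables of `Q` is surjective onto the
assignments of `Q`, because the database satisfies the tgd. Hence the step is sound exactly when
this restriction is injective on every database satisfying the dependencies; for the "only if"
direction of this equivalence one uses that the sets of assignments are finite
(`CQ.finite_domRestrict_answers`). Two extensions of one assignment of `Q` are the same as one
assignment of the associated test query. Assignments of a query extend along a chase sequence
(`ChaseSeq.exists_holds`), so if the chase identifies the two copies of each existential variable,
any two extensions agree. Conversely, if some terminal chase result keeps two copies apart, its
canonical database, with the variables turned into new constants of `C`
(`CQ.realize`, `CQ.realize_models`), satisfies the dependencies and carries two different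
extensions of one assignment of `Q`.
-/

namespace BagSetChase

variable {S : Schema} {C : Type} {k : ℕ}

/-! ### Evaluation, substitution and homomorphisms -/

theorem Term.eval_subst {A : Type} (ι : C → A) (γ : ℕ → A) (s : ℕ → Term C) (t : Term C) :
    (t.subst s).eval ι γ = t.eval ι (fun x => (s x).eval ι γ) := by
  cases t <;> rfl

theorem Term.eval_congr {A : Type} {ι : C → A} {γ γ' : ℕ → A} {t : Term C}
    (h : ∀ x, t = .var x → γ x = γ' x) : t.eval ι γ = t.eval ι γ' := by
  cases t with
  | var x => exact h x rfl
  | const c => rfl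

theorem holds_congr {A : Type} {ι : C → A} {D : Instance S A} {γ γ' : ℕ → A}
    {φ : List (Atom S C)} (h : ∀ x ∈ conjVars φ, γ x = γ' x) (hγ : Holds ι D γ φ) :
    Holds ι D γ' φ := by
  intro a ha
  have : (fun i => (a.args i).eval ι γ') = fun i => (a.args i).eval ι γ := by
    funext i
    exact Term.eval_congr fun x hx => (h x ⟨a, ha, i, hx⟩).symm
  rw [this]
  exact hγ a ha

theorem holds_append {A : Type} {ι : C → A} {D : Instance S A} {γ : ℕ → A}
    {φ ψ : List (Atom S C)} :
    Holds ι D γ (φ ++ ψ) ↔ Holds ι D γ φ ∧ Holds ι D γ ψ := by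
  simp only [Holds, List.mem_append, or_imp, forall_and]

theorem holds_map_subst {A : Type} {ι : C → A} {D : Instance S A} {γ : ℕ → A}
    {s : ℕ → Term C} {φ : List (Atom S C)} :
    Holds ι D γ (φ.map (Atom.subst s)) ↔ Holds ι D (fun x => (s x).eval ι γ) φ := by
  simp only [Holds, List.forall_mem_map, Atom.subst, Term.eval_subst]
  rfl

theorem Holds.comp_hom {A : Type} {ι : C → A} {D : Instance S A} {γ : ℕ → A}
    {h : ℕ → Term C} {φ ξ : List (Atom S C)} (hγ : Holds ι D γ ξ) (hh : IsHom h φ ξ) :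
    Holds ι D (fun x => (h x).eval ι γ) φ := by
  rw [← holds_map_subst]
  intro a ha
  obtain ⟨b, hb, rfl⟩ := List.mem_map.1 ha
  exact hγ _ (hh b hb)

theorem IsHom.mem_conjVars {h : ℕ → Term C} {φ ξ : List (Atom S C)} (hh : IsHom h φ ξ)
    {x y : ℕ} (hx : x ∈ conjVars φ) (hxy : h x = .var y) : y ∈ conjVars ξ := by
  obtain ⟨a, ha, i, hi⟩ := hx
  refine ⟨_, hh a ha, i, ?_⟩
  simp [Atom.subst, hi, Term.subst, Term.eval, hxy]

theorem IsHom.eval_congr {A : Type} {ι : C → A} {γ γ' : ℕ → A} {h : ℕ → Term C}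
    {φ ξ : List (Atom S C)} (hh : IsHom h φ ξ) (hγ : ∀ y ∈ conjVars ξ, γ y = γ' y)
    {x : ℕ} (hx : x ∈ conjVars φ) : (h x).eval ι γ = (h x).eval ι γ' :=
  Term.eval_congr fun y hy => hγ y (hh.mem_conjVars hx hy)

theorem conjVars_append (φ ψ : List (Atom S C)) :
    conjVars (φ ++ ψ) = conjVars φ ∪ conjVars ψ := by
  ext x
  simp only [conjVars, Set.mem_ofPred_eq, Set.mem_union, List.mem_append, or_and_right, exists_or]

theorem CQ.vars_extend (Q : CQ S C k) (ψ : List (Atom S C)) :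
    (Q.extend ψ).vars = Q.vars ∪ conjVars ψ :=
  conjVars_append _ _

/-! ### Instantiated right-hand sides of a tgd -/

theorem TGD.mem_conjVars_instRhs {t : TGD S C} {h : ℕ → Term C} {ρ : ℕ → ℕ} {z : ℕ}
    (hz : z ∈ t.exVars) : ρ z ∈ conjVars (t.instRhs h ρ) := by
  obtain ⟨⟨a, ha, i, hi⟩, hz'⟩ := hz
  refine ⟨_, List.mem_map_of_mem ha, i, ?_⟩
  simp [Atom.subst, hi, Term.subst, Term.eval, hz']

theorem TGD.conjVars_instRhs {t : TGD S C} {Q : CQ S C k} {h : ℕ → Term C} {ρ : ℕ → ℕ}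
    (hh : IsHom h t.lhs Q.body) {y : ℕ} (hy : y ∈ conjVars (t.instRhs h ρ)) :
    y ∈ Q.vars ∨ ∃ z ∈ t.exVars, y = ρ z := by
  obtain ⟨a, ha, i, hi⟩ := hy
  obtain ⟨b, hb, rfl⟩ := List.mem_map.1 ha
  cases hbi : b.args i with
  | const c => simp [Atom.subst, hbi, Term.subst, Term.eval] at hi
  | var x =>
    by_cases hx : x ∈ conjVars t.lhs
    · simp only [Atom.subst, hbi, Term.subst, Term.eval, hx, if_true] at hi
      exact .inl (hh.mem_conjVars hx hi)
    · simp only [Atom.subst, hbi, Term.subst, Term.eval, hx, if_false, Term.var.injEq] at hi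
      exact .inr ⟨x, ⟨⟨b, hb, i, hbi⟩, hx⟩, hi.symm⟩

/-- An assignment satisfies an instantiated right-hand side as soon as it gives the universal
variables (through `h`) and the existential variables (through `ρ`) the values of an assignment
that satisfies the right-hand side itself. -/
theorem TGD.holds_instRhs {A : Type} {ι : C → A} {D : Instance S A} {t : TGD S C}
    {h : ℕ → Term C} {ρ : ℕ → ℕ} {γ δ : ℕ → A} (hδ : Holds ι D δ t.rhs)
    (hlhs : ∀ x ∈ conjVars t.lhs, (h x).eval ι γ = δ x)
    (hex : ∀ z ∈ t.exVars, γ (ρ z) = δ z) : Holds ι D γ (t.instRhs h ρ) := by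
  rw [TGD.instRhs, holds_map_subst]
  refine holds_congr (fun x hx => ?_) hδ
  by_cases hx' : x ∈ conjVars t.lhs
  · simp only [hx', if_true, hlhs x hx']
  · simp only [hx', if_false]
    exact (hex x ⟨hx, hx'⟩).symm

/-- Satisfaction of an instantiated right-hand side does not depend on the names chosen for the
existential variables. -/
theorem TGD.holds_instRhs_rename {A : Type} {ι : C → A} {D : Instance S A} {t : TGD S C}
    {Q : CQ S C k} {h : ℕ → Term C} {ρ ρ' : ℕ → ℕ} {γ γ' : ℕ → A}
    (hh : IsHom h t.lhs Q.body) (hγ : Holds ι D γ (t.instRhs h ρ))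
    (hQ : ∀ x ∈ Q.vars, γ' x = γ x) (hex : ∀ z ∈ t.exVars, γ' (ρ' z) = γ (ρ z)) :
    Holds ι D γ' (t.instRhs h ρ') := by
  rw [TGD.instRhs, holds_map_subst] at hγ
  refine TGD.holds_instRhs hγ (fun x hx => ?_) fun z hz => ?_
  · simp only [hx, if_true]
    exact hh.eval_congr hQ hx
  · simp only [hz.2, if_false]
    exact hex z hz

/-- The values of fresh variables can be prescribed without changing an assignment on the
variables of the query. -/
theorem TGD.Fresh.exists_extension {A : Type} {t : TGD S C} {Q : CQ S C k} {ρ : ℕ → ℕ}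
    (hρ : t.Fresh Q ρ) (γ δ : ℕ → A) :
    ∃ γ' : ℕ → A, (∀ x ∈ Q.vars, γ' x = γ x) ∧ ∀ z ∈ t.exVars, γ' (ρ z) = δ z := by
  classical
  refine ⟨fun y => if y ∈ Q.vars then γ y else δ (Function.invFunOn ρ t.exVars y),
    fun x hx => by simp [hx], fun z hz => ?_⟩
  simp only [hρ.2 z hz, if_false]
  rw [hρ.1.leftInvOn_invFunOn hz]

/-- Two separate sets of fresh variables can be given prescribed values simultaneously. -/
theorem TGD.TestRenaming.exists_extension {A : Type} {t : TGD S C} {Q : CQ S C k} {ρ θ : ℕ → ℕ}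
    (hr : t.TestRenaming Q ρ θ) (γ δ ε : ℕ → A) :
    ∃ γ' : ℕ → A, (∀ x ∈ Q.vars, γ' x = γ x) ∧ (∀ z ∈ t.exVars, γ' (ρ z) = δ z) ∧
      ∀ z ∈ t.exVars, γ' (θ z) = ε z := by
  classical
  obtain ⟨γ₁, hγ₁, hδ⟩ := hr.1.exists_extension γ δ
  refine ⟨fun y => if y ∈ θ '' t.exVars then ε (Function.invFunOn θ t.exVars y) else γ₁ y,
    fun x hx => ?_, fun z hz => ?_, fun z hz => ?_⟩
  · have : x ∉ θ '' t.exVars := by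
      rintro ⟨z, hz, rfl⟩
      exact hr.2.1.2 z hz hx
    simp only [this, if_false, hγ₁ x hx]
  · have : ρ z ∉ θ '' t.exVars := by
      rintro ⟨w, hw, e⟩
      exact hr.2.2 z hz w hw e.symm
    simp only [this, if_false, hδ z hz]
  · simp only [Set.mem_image_of_mem θ hz, if_true]
    rw [hr.2.1.1.leftInvOn_invFunOn hz]

/-- In an instance that satisfies a tgd, an assignment of a query extends to the result of the
chase step with that tgd. -/
theorem TGD.exists_holds_extend {A : Type} {ι : C → A} {D : Instance S A} {t : TGD S C}
    {Q : CQ S C k} {h : ℕ → Term C} {ρ : ℕ → ℕ} {γ : ℕ → A}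
    (hD : (Dependency.tgd t).SatIn ι D) (hh : IsHom h t.lhs Q.body) (hρ : t.Fresh Q ρ)
    (hγ : Holds ι D γ Q.body) :
    ∃ γ' : ℕ → A, (∀ x ∈ Q.vars, γ' x = γ x) ∧ Holds ι D γ' (Q.extend (t.instRhs h ρ)).body := by
  obtain ⟨δ, hδ, hδr⟩ := hD _ (hγ.comp_hom hh)
  obtain ⟨γ', hγ', hex⟩ := hρ.exists_extension γ δ
  refine ⟨γ', hγ', holds_append.2 ⟨holds_congr (fun x hx => (hγ' x hx).symm) hγ,
    TGD.holds_instRhs hδr (fun x hx => ?_) hex⟩⟩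
  rw [hδ x hx]
  exact hh.eval_congr hγ' hx

/-! ### Soundness of the chase -/

/-- In an instance satisfying the egd of a chase step, assignments are invariant under the
substitution made by the step. -/
theorem EGD.eval_update {A : Type} {ι : C → A} {D : Instance S A} {e : EGD S C}
    {h : ℕ → Term C} {ξ : List (Atom S C)} {x : ℕ} {v : Term C} {γ : ℕ → A}
    (hD : (Dependency.egd e).SatIn ι D) (hh : IsHom h e.lhs ξ)
    (heq : (e.left.subst h = Term.var x ∧ e.right.subst h = v) ∨
      (e.right.subst h = Term.var x ∧ e.left.subst h = v))
    (hγ : Holds ι D γ ξ) :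
    (fun y => ((Function.update Term.var x v : ℕ → Term C) y).eval ι γ) = γ := by
  have key := hD _ (hγ.comp_hom hh)
  rw [← Term.eval_subst, ← Term.eval_subst] at key
  have hv : v.eval ι γ = γ x := by
    rcases heq with ⟨h1, h2⟩ | ⟨h1, h2⟩ <;> rw [h1, h2] at key
    · exact key.symm
    · exact key
  funext y
  by_cases hy : y = x
  · subst hy
    simpa using hv
  · simp [Function.update_of_ne hy, Term.eval]

theorem Atom.subst_var (a : Atom S C) : a.subst Term.var = a := by
  have : ∀ t : Term C, t.subst Term.var = t := fun t => by cases t <;> rfl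
  simp [Atom.subst, this]

theorem Atom.subst_subst (s s' : ℕ → Term C) (a : Atom S C) :
    (a.subst s).subst s' = a.subst fun x => (s x).subst s' := by
  simp only [Atom.subst, Term.subst, Atom.mk.injEq, heq_eq_eq, true_and]
  funext i
  exact Term.eval_subst _ _ _ _

theorem ChaseStep.isHom {d : Dependency S C} {h s : ℕ → Term C} {Q Q' : CQ S C k}
    (hs : ChaseStep d h s Q Q') : IsHom s Q.body Q'.body := by
  cases hs with
  | tgd happ hρ =>
    intro a ha
    rw [Atom.subst_var]
    exact List.mem_append_left _ ha
  | egd hhom heq hne => exact fun a ha => List.mem_map_of_mem ha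

/-- The substitution recorded by a chase sequence is a homomorphism between the bodies. -/
theorem ChaseSeq.isHom {Γ : Set (Dependency S C)} {s : ℕ → Term C} {Q Q' : CQ S C k}
    (hs : ChaseSeq Γ s Q Q') : IsHom s Q.body Q'.body := by
  induction hs with
  | refl Q =>
    intro a ha
    rwa [Atom.subst_var]
  | step _ _ hstep ih =>
    intro a ha
    rw [← Atom.subst_subst]
    exact hstep.isHom _ (ih a ha)

theorem ChaseStep.exists_holds {A : Type} {ι : C → A} {D : Instance S A}
    {d : Dependency S C} {h s : ℕ → Term C} {Q Q' : CQ S C k} {γ : ℕ → A}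
    (hs : ChaseStep d h s Q Q') (hD : d.SatIn ι D) (hγ : Holds ι D γ Q.body) :
    ∃ γ' : ℕ → A, Holds ι D γ' Q'.body ∧ ∀ x ∈ Q.vars, (s x).eval ι γ' = γ x := by
  cases hs with
  | tgd happ hρ =>
    obtain ⟨γ', hγ', hb⟩ := TGD.exists_holds_extend hD happ.1 hρ hγ
    exact ⟨γ', hb, hγ'⟩
  | egd hhom heq hne =>
    have key := EGD.eval_update hD hhom heq hγ
    refine ⟨γ, ?_, fun y _ => congrFun key y⟩
    rw [CQ.subst, holds_map_subst, key]
    exact hγ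

/-- In an instance that satisfies the dependencies, every assignment of a query factors through
the substitution recorded by a chase sequence, followed by an assignment of the last query. -/
theorem ChaseSeq.exists_holds {A : Type} {ι : C → A} {D : Instance S A}
    {Γ : Set (Dependency S C)} {s : ℕ → Term C} {Q Q' : CQ S C k} {γ : ℕ → A}
    (hs : ChaseSeq Γ s Q Q') (hD : ∀ d ∈ Γ, d.SatIn ι D) (hγ : Holds ι D γ Q.body) :
    ∃ γ' : ℕ → A, Holds ι D γ' Q'.body ∧ ∀ x ∈ Q.vars, (s x).eval ι γ' = γ x := by
  induction hs with
  | refl Q => exact ⟨γ, hγ, fun x _ => rfl⟩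
  | step hseq hd hstep ih =>
    obtain ⟨γ₁, hγ₁, h₁⟩ := ih hγ
    obtain ⟨γ₂, hγ₂, h₂⟩ := hstep.exists_holds (hD _ hd) hγ₁
    refine ⟨γ₂, hγ₂, fun x hx => ?_⟩
    rw [Term.eval_subst, ← h₁ x hx]
    exact hseq.isHom.eval_congr h₂ hx

/-! ### Counting assignments -/

/-- The (total) assignments that satisfy the body of `Q` in `D` and map its head to `u`. -/
def CQ.answers (Q : CQ S C k) (D : Database S C) (u : Fin k → C) : Set (ℕ → C) :=
  {γ | Holds id D.inst γ Q.body ∧ (fun i => (Q.head i).eval id γ) = u}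

theorem CQ.head_eval_congr {Q : CQ S C k} {γ γ' : ℕ → C} (h : ∀ x ∈ Q.vars, γ x = γ' x) :
    (fun i => (Q.head i).eval id γ) = fun i => (Q.head i).eval id γ' :=
  funext fun i => Term.eval_congr fun x hx => h x (Q.safe i x hx)

theorem domRestrict_image_eq {α β : Type} {U V : Set α} (hUV : U ⊆ V) (G : Set (α → β)) :
    U.domRestrict '' G = (fun p (x : U) => p ⟨x, hUV x.2⟩) '' (V.domRestrict '' G) := by
  rw [Set.image_image]
  rfl

theorem encard_domRestrict_eq {α β : Type} {U V : Set α} (hUV : U ⊆ V) {G : Set (α → β)}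
    (hG : ∀ γ₁ ∈ G, ∀ γ₂ ∈ G, (∀ x ∈ U, γ₁ x = γ₂ x) → ∀ x ∈ V, γ₁ x = γ₂ x) :
    (U.domRestrict '' G).encard = (V.domRestrict '' G).encard := by
  rw [domRestrict_image_eq hUV]
  apply Set.InjOn.encard_image
  rintro _ ⟨γ₁, h₁, rfl⟩ _ ⟨γ₂, h₂, rfl⟩ h
  funext x
  exact hG γ₁ h₁ γ₂ h₂ (fun y hy => congrFun h ⟨y, hy⟩) x x.2

theorem eq_of_encard_domRestrict_eq {α β : Type} {U V : Set α} (hUV : U ⊆ V) {G : Set (α → β)}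
    (hfin : (V.domRestrict '' G).Finite)
    (hcard : (U.domRestrict '' G).encard = (V.domRestrict '' G).encard)
    {γ₁ γ₂ : α → β} (h₁ : γ₁ ∈ G) (h₂ : γ₂ ∈ G) (h : ∀ x ∈ U, γ₁ x = γ₂ x) :
    ∀ x ∈ V, γ₁ x = γ₂ x := by
  rw [domRestrict_image_eq hUV] at hcard
  have hinj := hfin.injOn_of_encard_image_eq hcard
  have := hinj (Set.mem_image_of_mem _ h₁) (Set.mem_image_of_mem _ h₂)
    (funext fun x => h x x.2)
  exact fun x hx => congrFun this ⟨x, hx⟩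

theorem finite_conjVars (φ : List (Atom S C)) : (conjVars φ).Finite := by
  have : conjVars φ ⊆ ⋃ a ∈ {a | a ∈ φ}, a.vars := by
    rintro x ⟨a, ha, hx⟩
    exact Set.mem_biUnion (s := {a | a ∈ φ}) ha hx
  refine ((List.finite_toSet φ).biUnion fun a _ => ?_).subset this
  refine ((Set.finite_range a.args).preimage (f := Term.var) ?_).subset ?_
  · intro x _ y _ h
    exact Term.var.inj h
  · rintro x ⟨i, hi⟩
    exact ⟨i, hi⟩

/-- All values of a satisfying assignment lie in the finite active domain of the database, so a
query has finitely many of them. -/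
theorem CQ.finite_domRestrict_answers (Q : CQ S C k) (D : Database S C) (u : Fin k → C) :
    (Q.vars.domRestrict '' Q.answers D u).Finite := by
  have := S.finite_rel
  let dom : Set C := ⋃ r : S.Rel, ⋃ w ∈ D.inst r, Set.range w
  have hdom : dom.Finite := Set.finite_iUnion fun r =>
    (D.finite_inst r).biUnion fun w _ => Set.finite_range w
  have : Finite Q.vars := (finite_conjVars Q.body).to_subtype
  refine (Set.Finite.pi' (t := fun _ : Q.vars => dom) fun _ => hdom).subset ?_
  rintro _ ⟨γ, hγ, rfl⟩ ⟨x, a, ha, i, hi⟩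
  have hx : γ x = (a.args i).eval id γ := by rw [hi]; rfl
  simp only [Set.domRestrict_apply, hx]
  exact Set.mem_iUnion.2 ⟨a.rel, Set.mem_biUnion (hγ.1 a ha) ⟨i, rfl⟩⟩

/-! ### Egd steps -/

theorem ChaseStep.bagSetEquiv_of_egd {Γ : Set (Dependency S C)} {e : EGD S C}
    {h s : ℕ → Term C} {Q Q' : CQ S C k} (hs : ChaseStep (.egd e) h s Q Q')
    (he : Dependency.egd e ∈ Γ) : BagSetEquiv Γ Q Q' := by
  intro D hD u
  have hhomS := hs.isHom
  cases hs with
  | @egd _ _ _ x v hhom heq hne =>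
  set s : ℕ → Term C := Function.update Term.var x v with hs
  have hvars : ∀ y ∈ (Q.subst s).vars, y ∈ Q.vars ∧ y ≠ x := by
    rintro y ⟨a, ha, i, hi⟩
    obtain ⟨b, hb, rfl⟩ := List.mem_map.1 ha
    cases hbi : b.args i with
    | const c => simp [Atom.subst, hbi, Term.subst, Term.eval] at hi
    | var w =>
      simp only [Atom.subst, hbi, Term.subst, Term.eval] at hi
      by_cases hw : w = x
      · rw [hw, hs, Function.update_self] at hi
        subst hi
        refine ⟨?_, fun hyx => hne (by rw [hyx])⟩
        -- The replacing variable `y` occurs in `Q`, being the image of a variable of the egd.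
        have aux : ∀ t : Term C, (∀ z, t = .var z → z ∈ conjVars e.lhs) →
            t.subst h = .var y → y ∈ Q.vars := by
          intro t ht hty
          cases t with
          | const c => simp [Term.subst, Term.eval] at hty
          | var z => exact hhom.mem_conjVars (ht z rfl) hty
        rcases heq with ⟨_, h2⟩ | ⟨_, h2⟩
        · exact aux _ e.right_mem h2
        · exact aux _ e.left_mem h2
      · rw [hs, Function.update_of_ne hw] at hi
        cases hi
        exact ⟨⟨b, hb, i, hbi⟩, hw⟩
  have hinv : ∀ γ ∈ Q.answers D u, (fun y => (s y).eval id γ) = γ := fun γ hγ =>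
    EGD.eval_update (hD _ he) hhom heq hγ.1
  have hmem : ∀ γ, γ ∈ (Q.subst s).answers D u ↔ (fun y => (s y).eval id γ) ∈ Q.answers D u := by
    intro γ
    simp only [CQ.answers, CQ.subst, Set.mem_ofPred_eq, holds_map_subst, Term.eval_subst]
  have himage : (Q.subst s).vars.domRestrict '' (Q.subst s).answers D u =
      (Q.subst s).vars.domRestrict '' Q.answers D u := by
    apply Set.Subset.antisymm
    · rintro _ ⟨γ, hγ, rfl⟩
      refine ⟨_, (hmem γ).1 hγ, ?_⟩
      funext y
      have := (hvars y y.2).2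
      simp [hs, Function.update_of_ne this, Term.eval]
    · rintro _ ⟨γ, hγ, rfl⟩
      refine ⟨γ, (hmem γ).2 ?_, rfl⟩
      rwa [hinv γ hγ]
  change (Q.vars.domRestrict '' Q.answers D u).encard =
    ((Q.subst s).vars.domRestrict '' (Q.subst s).answers D u).encard
  rw [himage]
  refine (encard_domRestrict_eq (fun y hy => (hvars y hy).1) ?_).symm
  intro γ₁ h₁ γ₂ h₂ h12 y hy
  rw [← hinv γ₁ h₁, ← hinv γ₂ h₂]
  exact hhomS.eval_congr h12 hy

/-! ### Tgd steps as restriction of assignments -/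

theorem TGD.domRestrict_answers_extend {D : Database S C} {t : TGD S C} {Q : CQ S C k}
    {h : ℕ → Term C} {ρ : ℕ → ℕ} (hD : (Dependency.tgd t).SatIn id D.inst)
    (hh : IsHom h t.lhs Q.body) (hρ : t.Fresh Q ρ) (u : Fin k → C) :
    Q.vars.domRestrict '' Q.answers D u =
      Q.vars.domRestrict '' (Q.extend (t.instRhs h ρ)).answers D u := by
  apply Set.Subset.antisymm
  · rintro _ ⟨γ, hγ, rfl⟩
    obtain ⟨γ', hγ', hb⟩ := TGD.exists_holds_extend hD hh hρ hγ.1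
    exact ⟨γ', ⟨hb, (CQ.head_eval_congr hγ').trans hγ.2⟩, funext fun x => hγ' x x.2⟩
  · rintro _ ⟨γ, hγ, rfl⟩
    exact ⟨γ, ⟨(holds_append.1 hγ.1).1, hγ.2⟩, rfl⟩

theorem TGD.bagSetEquiv_of_assignmentFixing {Γ : Set (Dependency S C)} {t : TGD S C}
    {Q : CQ S C k} {h : ℕ → Term C} {ρ : ℕ → ℕ} (ht : Dependency.tgd t ∈ Γ)
    (hρ : t.Fresh Q ρ) (hfix : AssignmentFixing Γ Q t h) :
    BagSetEquiv Γ Q (Q.extend (t.instRhs h ρ)) := by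
  obtain ⟨⟨hh, -⟩, ρ₀, θ₀, hr, s, Qn, ⟨hseq, -⟩, hs⟩ := hfix
  intro D hD u
  change (Q.vars.domRestrict '' Q.answers D u).encard =
    ((Q.extend _).vars.domRestrict '' (Q.extend (t.instRhs h ρ)).answers D u).encard
  rw [TGD.domRestrict_answers_extend (hD _ ht) hh hρ]
  have hsub : Q.vars ⊆ (Q.extend (t.instRhs h ρ)).vars := by
    rw [CQ.vars_extend]
    exact Set.subset_union_left
  refine encard_domRestrict_eq hsub fun γ₁ h₁ γ₂ h₂ h12 => ?_
  have hγ₁ := holds_append.1 h₁.1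
  have hγ₂ := holds_append.1 h₂.1
  -- Two extensions of one assignment of `Q` combine to an assignment of the test query.
  obtain ⟨γ, hγQ, hγρ, hγθ⟩ := hr.exists_extension γ₁ (fun z => γ₁ (ρ z)) (fun z => γ₂ (ρ z))
  have htest : Holds id D.inst γ (t.testQuery Q h ρ₀ θ₀).body := by
    refine holds_append.2 ⟨holds_congr (fun x hx => (hγQ x hx).symm) hγ₁.1, holds_append.2 ⟨?_, ?_⟩⟩
    · exact TGD.holds_instRhs_rename hh hγ₁.2 hγQ hγρ
    · exact TGD.holds_instRhs_rename hh hγ₂.2 (fun x hx => (hγQ x hx).trans (h12 x hx)) hγθ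
  obtain ⟨γ', -, hγ'⟩ := hseq.exists_holds hD htest
  intro y hy
  rw [CQ.vars_extend] at hy
  have hex : ∀ z ∈ t.exVars, γ₁ (ρ z) = γ₂ (ρ z) := by
    intro z hz
    have hρz : ρ₀ z ∈ (t.testQuery Q h ρ₀ θ₀).vars := by
      rw [TGD.testQuery, CQ.vars_extend, conjVars_append]
      exact .inr (.inl (TGD.mem_conjVars_instRhs hz))
    have hθz : θ₀ z ∈ (t.testQuery Q h ρ₀ θ₀).vars := by
      rw [TGD.testQuery, CQ.vars_extend, conjVars_append]
      exact .inr (.inr (TGD.mem_conjVars_instRhs hz))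
    rw [← hγρ z hz, ← hγθ z hz, ← hγ' _ hρz, ← hγ' _ hθz, hs z hz]
  rcases hy with hy | hy
  · exact h12 y hy
  · rcases TGD.conjVars_instRhs hh hy with hy | ⟨z, hz, rfl⟩
    · exact h12 y hy
    · exact hex z hz

/-! ### Realizing canonical databases over the constants -/

/-- The terms that occur in a conjunction of atoms. -/
def conjTerms (φ : List (Atom S C)) : Set (Term C) := {t | ∃ a ∈ φ, t ∈ Set.range a.args}

theorem finite_conjTerms (φ : List (Atom S C)) : (conjTerms φ).Finite := by
  have : conjTerms φ ⊆ ⋃ a ∈ {a | a ∈ φ}, Set.range a.args := by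
    rintro x ⟨a, ha, hx⟩
    exact Set.mem_biUnion (s := {a | a ∈ φ}) ha hx
  exact ((List.finite_toSet φ).biUnion fun a _ => Set.finite_range a.args).subset this

/-- The left-hand side of a dependency. -/
def Dependency.lhs : Dependency S C → List (Atom S C)
  | .tgd t => t.lhs
  | .egd e => e.lhs

/-- The canonical database of a query as a database over `C`, where the variables are turned into
constants by `e`. -/
def CQ.realize (Q : CQ S C k) (e : ℕ → C) : Database S C where
  inst := fun r => (fun w i => (w i).eval id e) '' Q.canonical r
  finite_inst := by
    intro r
    refine Set.Finite.image _ ?_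
    refine (List.finite_toSet Q.body).preimage (f := fun w => (⟨r, w⟩ : Atom S C)) ?_
    intro w _ w' _ hw
    simpa using hw

theorem CQ.holds_realize {Q : CQ S C k} {e : ℕ → C} {γ : ℕ → Term C} {φ : List (Atom S C)}
    (hγ : Holds Term.const Q.canonical γ φ) :
    Holds id (Q.realize e).inst (fun x => (γ x).eval id e) φ := by
  intro a ha
  exact ⟨_, hγ a ha, funext fun i => Term.eval_subst id e γ (a.args i)⟩

/-- Conversely, satisfaction in the realization lifts to the canonical database for conjunctions
on whose terms, together with those of `Q`, the realization is faithful. -/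
theorem CQ.exists_holds_canonical {Q : CQ S C k} {e : ℕ → C} {T : Set (Term C)}
    (hinj : Set.InjOn (Term.eval id e) T) (hQ : conjTerms Q.body ⊆ T) {φ : List (Atom S C)}
    (hφ : conjTerms φ ⊆ T) {γ : ℕ → C} (hγ : Holds id (Q.realize e).inst γ φ) :
    ∃ γ' : ℕ → Term C, Holds Term.const Q.canonical γ' φ ∧
      ∀ x ∈ conjVars φ, (γ' x).eval id e = γ x := by
  have : Nonempty (Term C) := ⟨.var 0⟩
  let g : C → Term C := Function.invFunOn (Term.eval id e) T
  have hg : ∀ t ∈ T, g (t.eval id e) = t := hinj.leftInvOn_invFunOn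
  have lift : ∀ a ∈ φ, ∃ w ∈ Q.canonical a.rel,
      ∀ i, w i ∈ T ∧ (w i).eval id e = (a.args i).eval id γ := by
    intro a ha
    obtain ⟨w, hw, hwa⟩ := hγ a ha
    exact ⟨w, hw, fun i => ⟨hQ ⟨_, hw, i, rfl⟩, congrFun hwa i⟩⟩
  refine ⟨fun x => g (γ x), fun a ha => ?_, ?_⟩
  · obtain ⟨w, hw, hwT⟩ := lift a ha
    suffices w = fun i => (a.args i).eval Term.const (fun x => g (γ x)) by rwa [← this]
    funext i
    obtain ⟨hT, he⟩ := hwT i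
    cases hai : a.args i with
    | var x =>
      rw [hai] at he
      change w i = g (γ x)
      rw [← hg _ hT, he]
      rfl
    | const c =>
      rw [hai] at he
      exact hinj hT (hφ ⟨a, ha, i, hai⟩) he
  · rintro x ⟨a, ha, i, hi⟩
    obtain ⟨w, -, hwT⟩ := lift a ha
    obtain ⟨hT, he⟩ := hwT i
    rw [hi] at he
    have he' : (w i).eval id e = γ x := he
    change (g (γ x)).eval id e = γ x
    rw [← he', hg _ hT]

theorem CQ.realize_models {Q : CQ S C k} {Γ : Set (Dependency S C)} {e : ℕ → C}
    {T : Set (Term C)} (hinj : Set.InjOn (Term.eval id e) T) (hQ : conjTerms Q.body ⊆ T)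
    (hΓ : ∀ d ∈ Γ, conjTerms d.lhs ⊆ T) (hsat : ∀ d ∈ Γ, d.SatIn Term.const Q.canonical) :
    (Q.realize e).Models Γ := by
  intro d hd
  cases d with
  | tgd t =>
    intro γ hγ
    obtain ⟨γ', hγ', hval⟩ := CQ.exists_holds_canonical hinj hQ (hΓ _ hd) hγ
    obtain ⟨δ, hδ, hδr⟩ := hsat _ hd γ' hγ'
    refine ⟨_, fun x hx => ?_, CQ.holds_realize hδr⟩
    rw [hδ x hx]
    exact hval x hx
  | egd d =>
    intro γ hγ
    obtain ⟨γ', hγ', hval⟩ := CQ.exists_holds_canonical hinj hQ (hΓ _ hd) hγ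
    have key : ∀ t : Term C, (∀ x, t = .var x → x ∈ conjVars d.lhs) →
        (t.eval Term.const γ').eval id e = t.eval id γ := by
      intro t ht
      cases t with
      | const c => rfl
      | var x => exact hval x (ht x rfl)
    rw [← key _ d.left_mem, ← key _ d.right_mem]
    exact congrArg _ (hsat _ hd γ' hγ')

/-- Over infinitely many constants, the variables can be turned into constants faithfully with
respect to any finite set of terms. -/
theorem exists_injOn_eval [Infinite C] {T : Set (Term C)} (hT : T.Finite) :
    ∃ e : ℕ → C, Set.InjOn (Term.eval id e) T := by
  have hK : (Term.const ⁻¹' T : Set C).Finite :=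
    hT.preimage fun c _ c' _ h => Term.const.inj h
  have := hK.infinite_compl.to_subtype
  let e : ℕ ↪ ((Term.const ⁻¹' T : Set C)ᶜ : Set C) := Infinite.natEmbedding _
  have hne : ∀ x c, Term.const c ∈ T → (e x : C) ≠ c := by
    rintro x c hc rfl
    exact (e x).2 hc
  refine ⟨fun n => e n, ?_⟩
  rintro (x | c) hx (y | c') hy h
  · exact congrArg _ (e.injective (Subtype.ext h))
  · exact absurd h (hne x c' hy)
  · exact absurd h.symm (hne y c hx)
  · exact congrArg _ h

/-- A sound tgd step is assignment fixing: every terminal chase result of the test query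
identifies the two copies of each existential variable. -/
theorem TGD.subst_eq_of_bagSetEquiv [Infinite C] {Γ : Set (Dependency S C)} (hfin : Γ.Finite)
    {t : TGD S C} {Q Qn : CQ S C k} {h s : ℕ → Term C} {ρ ρ₀ θ₀ : ℕ → ℕ}
    (ht : Dependency.tgd t ∈ Γ) (hh : IsHom h t.lhs Q.body) (hρ : t.Fresh Q ρ)
    (hequiv : BagSetEquiv Γ Q (Q.extend (t.instRhs h ρ)))
    (hterm : IsTerminalChase Γ (t.testQuery Q h ρ₀ θ₀) s Qn) :
    ∀ z ∈ t.exVars, s (ρ₀ z) = s (θ₀ z) := by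
  obtain ⟨hseq, hsat⟩ := hterm
  let T : Set (Term C) := conjTerms Qn.body ∪ ⋃ d ∈ Γ, conjTerms d.lhs
  have hTfin : T.Finite :=
    (finite_conjTerms _).union (hfin.biUnion fun d _ => finite_conjTerms d.lhs)
  obtain ⟨e, hinj⟩ := exists_injOn_eval hTfin
  have hD : (Qn.realize e).Models Γ :=
    CQ.realize_models hinj Set.subset_union_left
      (fun d hd => (Set.subset_biUnion_of_mem (u := fun d : Dependency S C => conjTerms d.lhs)
        hd).trans Set.subset_union_right) hsat
  set D := Qn.realize e
  -- The assignment of the test query that is given by the chase.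
  let γ : ℕ → C := fun x => (s x).eval id e
  have hcan : Holds Term.const Qn.canonical s (t.testQuery Q h ρ₀ θ₀).body := fun a ha =>
    hseq.isHom a ha
  have hγ : Holds id D.inst γ (t.testQuery Q h ρ₀ θ₀).body := CQ.holds_realize hcan
  obtain ⟨hγQ, hγρθ⟩ := holds_append.1 hγ
  obtain ⟨hγρ, hγθ⟩ := holds_append.1 hγρθ
  let u : Fin k → C := fun i => (Q.head i).eval id γ
  -- Each copy of the existential variables gives an extension of `γ` to the chased query.
  have hext : ∀ ρ' : ℕ → ℕ, Holds id D.inst γ (t.instRhs h ρ') →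
      ∃ γ' ∈ (Q.extend (t.instRhs h ρ)).answers D u, (∀ x ∈ Q.vars, γ' x = γ x) ∧
        ∀ z ∈ t.exVars, γ' (ρ z) = γ (ρ' z) := by
    intro ρ' hρ'
    obtain ⟨γ', hQ', hex⟩ := hρ.exists_extension γ fun z => γ (ρ' z)
    exact ⟨γ', ⟨holds_append.2 ⟨holds_congr (fun x hx => (hQ' x hx).symm) hγQ,
      TGD.holds_instRhs_rename hh hρ' hQ' hex⟩, CQ.head_eval_congr (Q := Q) hQ'⟩, hQ', hex⟩
  obtain ⟨γ₁, h₁, hQ₁, hex₁⟩ := hext ρ₀ hγρ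
  obtain ⟨γ₂, h₂, hQ₂, hex₂⟩ := hext θ₀ hγθ
  have hsub : Q.vars ⊆ (Q.extend (t.instRhs h ρ)).vars := by
    rw [CQ.vars_extend]
    exact Set.subset_union_left
  have hcard : (Q.vars.domRestrict '' Q.answers D u).encard =
      ((Q.extend _).vars.domRestrict '' (Q.extend (t.instRhs h ρ)).answers D u).encard :=
    hequiv D hD u
  rw [TGD.domRestrict_answers_extend (hD _ ht) hh hρ] at hcard
  have heq := eq_of_encard_domRestrict_eq hsub (CQ.finite_domRestrict_answers _ D u) hcard h₁ h₂
    fun x hx => (hQ₁ x hx).trans (hQ₂ x hx).symm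
  intro z hz
  have hmemT : ∀ x ∈ (t.testQuery Q h ρ₀ θ₀).vars, s x ∈ T := by
    rintro x ⟨a, ha, i, hi⟩
    refine .inl ⟨_, hseq.isHom a ha, i, ?_⟩
    simp [Atom.subst, hi, Term.subst, Term.eval]
  have hρz : ρ₀ z ∈ (t.testQuery Q h ρ₀ θ₀).vars := by
    rw [TGD.testQuery, CQ.vars_extend, conjVars_append]
    exact .inr (.inl (TGD.mem_conjVars_instRhs hz))
  have hθz : θ₀ z ∈ (t.testQuery Q h ρ₀ θ₀).vars := by
    rw [TGD.testQuery, CQ.vars_extend, conjVars_append]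
    exact .inr (.inr (TGD.mem_conjVars_instRhs hz))
  refine hinj (hmemT _ hρz) (hmemT _ hθz) ?_
  have hz' : ρ z ∈ (Q.extend (t.instRhs h ρ)).vars := by
    rw [CQ.vars_extend]
    exact .inr (TGD.mem_conjVars_instRhs hz)
  exact (hex₁ z hz).symm.trans ((heq _ hz').trans (hex₂ z hz))

end BagSetChase

theorem theorem4p3 {S : BagSetChase.Schema} {C : Type} [Infinite C] {k : ℕ}
    (Γ : Set (BagSetChase.Dependency S C)) (hfin : Γ.Finite)
    (hreg : BagSetChase.IsRegularizedSet Γ)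
    (σ : BagSetChase.Dependency S C) (hσ : σ ∈ Γ)
    (Q Q' : BagSetChase.CQ S C k) (h s : ℕ → BagSetChase.Term C)
    (hstep : BagSetChase.ChaseStep σ h s Q Q')
    (hterm : ∀ t : BagSetChase.TGD S C, σ = BagSetChase.Dependency.tgd t →
      BagSetChase.TestChaseExists Γ Q t h) :
    BagSetChase.BagSetEquiv Γ Q Q' ↔
      (BagSetChase.IsAssignmentFixingStep Γ σ h Q ∨ σ.IsEgd) := by
  cases σ with
  | egd e => exact ⟨fun _ => .inr ⟨e, rfl⟩, fun _ => hstep.bagSetEquiv_of_egd hσ⟩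
  | tgd t =>
    obtain ⟨ρ₀, θ₀, hr, s', Qn, hQn⟩ := hterm t rfl
    cases hstep with
    | tgd happ hρ =>
      constructor
      · intro hequiv
        exact .inl ⟨t, rfl, hreg t hσ, happ, ρ₀, θ₀, hr, s', Qn, hQn,
          BagSetChase.TGD.subst_eq_of_bagSetEquiv hfin hσ happ.1 hρ hequiv hQn⟩
      · rintro (⟨t', ht', -, hfix⟩ | ⟨e, he⟩)
        · cases ht'
          exact BagSetChase.TGD.bagSetEquiv_of_assignmentFixing hσ hρ hfix
        · cases he
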